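/- Let $a,b,c\in\mathbb{R}$ and let $\epsilon=\{\epsilon_{i,j}\}_{i,j\in\mathbb{Z}}$ be pairwise uncorrelated real random variables on a probability space with $\mathsf{E}\,\epsilon_{i,j}=0$ and $\mathsf{E}\,\epsilon_{i,j}^2=\sigma_\epsilon^2$ for all $i,j$, where $0<\sigma_\epsilon^2<\infty$. Let $X=\{X_{i,j}\}_{i,j\in\mathbb{Z}}$ be a real wide-sense stationary random field (finite second moments, constant mean, and $\operatorname{cov}(X_{i,j},X_{i-h_1,j-h_2})$ depending only on $(h_1,h_2)$) such that, for all $i,j\in\mathbb{Z}$, almost surely \[ X_{i,j}=aX_{i-1,j}+bX_{i,j-1}+cX_{i-1,j-1}+\epsilon_{i,j}. \] The field $X$ is called causal with respect to $\epsilon$ if there are real coefficients $\psi_{k,l}$, $k,l\ge 0$, such that \[ \sum_{k=0}^\infty\sum_{l=0}^\infty|\psi_{k,l}|<\infty \qquad\text{and}\qquad X_{i,j}=\sum_{k=0}^\infty\sum_{l=0}^\infty\psi_{k,l}\,\epsilon_{i-k,j-l} \quad\text{for all } i,j\in\mathbb{Z}, \] where the series converges, and the equality holds, almost surely for each $(i,j)$.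 Then: 1. $X$ is causal with respect to $\epsilon$ if and only if \[ 1-a-b-c>0,\qquad 1-a+b+c>0,\qquad 1+a-b+c>0,\qquad 1+a+b-c>0 . \] 2. If $X$ is causal with respect to $\epsilon$, then the coefficients $\psi_{k,l}$ in any such representation equal \[ \psi_{k,l}=\sum_{m=0}^{\min(k,l)}\binom{k}{m}\binom{l}{m}a^{k-m}\,b^{l-m}\,(ab+c)^m \qquad (k,l\ge 0), \] with the convention $0^0=1$. -/

import Mathlib

open MeasureTheory ProbabilityTheory

/-- The field `ε` on the integer lattice consists of square-integrable, pairwise uncorrelated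
random variables with zero mean and common second moment (hence variance) `σ2`,
where `0 < σ2 < ∞`. -/
structure IsWhiteNoise {Ω : Type*} [MeasurableSpace Ω] (P : Measure Ω)
    (ε : ℤ → ℤ → Ω → ℝ) (σ2 : ℝ) : Prop where
  memLp : ∀ i j, MemLp (ε i j) 2 P
  mean_zero : ∀ i j, ∫ ω, ε i j ω ∂P = 0
  second_moment : ∀ i j, ∫ ω, (ε i j ω) ^ 2 ∂P = σ2
  pos : 0 < σ2
  uncorrelated : ∀ i j i' j', (i, j) ≠ (i', j') → covariance (ε i j) (ε i' j') P = 0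

/-- Wide-sense stationarity of a real random field on the integer lattice: finite second
moments, constant mean, and `cov(X_{i,j}, X_{i-h₁,j-h₂})` depends on `(h₁, h₂)` only. -/
structure IsWideSenseStationary {Ω : Type*} [MeasurableSpace Ω] (P : Measure Ω)
    (X : ℤ → ℤ → Ω → ℝ) : Prop where
  memLp : ∀ i j, MemLp (X i j) 2 P
  mean_const : ∃ m : ℝ, ∀ i j, ∫ ω, X i j ω ∂P = m
  cov_shift : ∃ γ : ℤ → ℤ → ℝ, ∀ i j h₁ h₂ : ℤ,
    covariance (X i j) (X (i - h₁) (j - h₂)) P = γ h₁ h₂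

/-- The planar autoregressive equation
`X_{i,j} = a X_{i-1,j} + b X_{i,j-1} + c X_{i-1,j-1} + ε_{i,j}`, almost surely at every
lattice point. -/
def SatisfiesPlanarAR {Ω : Type*} [MeasurableSpace Ω] (P : Measure Ω)
    (a b c : ℝ) (X ε : ℤ → ℤ → Ω → ℝ) : Prop :=
  ∀ i j : ℤ, ∀ᵐ ω ∂P,
    X i j ω = a * X (i - 1) j ω + b * X i (j - 1) ω + c * X (i - 1) (j - 1) ω + ε i j ω

/-- `ψ` is absolutely summable and `X_{i,j} = ∑_{k,l ≥ 0} ψ_{k,l} ε_{i-k,j-l}` almost surely at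
every lattice point, the double series being (unconditionally) convergent almost surely. -/
structure IsCausalRepresentation {Ω : Type*} [MeasurableSpace Ω] (P : Measure Ω)
    (X ε : ℤ → ℤ → Ω → ℝ) (ψ : ℕ → ℕ → ℝ) : Prop where
  summable_abs : Summable (fun p : ℕ × ℕ => |ψ p.1 p.2|)
  hasSum : ∀ i j : ℤ, ∀ᵐ ω ∂P,
    HasSum (fun p : ℕ × ℕ => ψ p.1 p.2 * ε (i - (p.1 : ℤ)) (j - (p.2 : ℤ)) ω) (X i j ω)

/-- The field `X` is causal with respect to `ε`. -/
def IsCausal {Ω : Type*} [MeasurableSpace Ω] (P : Measure Ω)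
    (X ε : ℤ → ℤ → Ω → ℝ) : Prop :=
  ∃ ψ : ℕ → ℕ → ℝ, IsCausalRepresentation P X ε ψ

/-! Let Q(z,w) = 1 - az - bw - czw. Substituting a causal series into the equation writes ε₀₀ as a
series in ε with coefficients `arResidual`; testing against each ε identifies them with `deltaSeq`.
This recursion determines ψ as `arCoeff`. As ψ is absolutely summable, its generating function
inverts Q on [-1,1]², so Q has no zero there, and Q(0,0) = 1 makes it positive at the corners.
Conversely, the corner inequalities yield a quadratic storage function (`IsARStable.exists_storage`)
under which row ℓ² norms of `arCoeff` do not increase. The coefficients are therefore bounded; as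
the inequalities are open, the same holds after a slight dilation, which gives geometric decay. The
series in X then converge almost surely, and summation by parts recovers X from ε. -/

/-! ### Shifts and summation by parts -/

/-- Shift of a double sequence in the first index, extended by zero. -/
def shiftFst (f : ℕ → ℕ → ℝ) : ℕ → ℕ → ℝ
  | 0, _ => 0
  | k + 1, l => f k l

/-- Shift of a double sequence in the second index, extended by zero. -/
def shiftSnd (f : ℕ → ℕ → ℝ) : ℕ → ℕ → ℝ
  | _, 0 => 0
  | k, l + 1 => f k l

/-- Coefficients of the product of `∑ ψ_{k,l} z^k w^l` and `1 - a z - b w - c z w`. -/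
def arResidual (a b c : ℝ) (ψ : ℕ → ℕ → ℝ) (k l : ℕ) : ℝ :=
  ψ k l - a * shiftFst ψ k l - b * shiftSnd ψ k l - c * shiftFst (shiftSnd ψ) k l

/-- The double sequence supported at the origin with value one. -/
def deltaSeq (k l : ℕ) : ℝ := if k = 0 ∧ l = 0 then 1 else 0

/-- Coefficients of the power series of `1 / (1 - a z - b w - c z w)`. -/
def arCoeff (a b c : ℝ) (k l : ℕ) : ℝ :=
  ∑ m ∈ Finset.range (min k l + 1),
    (k.choose m : ℝ) * (l.choose m : ℝ) * a ^ (k - m) * b ^ (l - m) * (a * b + c) ^ m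

theorem hasSum_congr_fun {ι : Type*} {f g : ι → ℝ} {s : ℝ} (h : ∀ i, f i = g i) :
    HasSum f s ↔ HasSum g s := by
  rw [funext h]

theorem hasSum_shiftFst_mul {f E : ℕ → ℕ → ℝ} {s : ℝ}
    (h : HasSum (fun p : ℕ × ℕ => f p.1 p.2 * E (p.1 + 1) p.2) s) :
    HasSum (fun p : ℕ × ℕ => shiftFst f p.1 p.2 * E p.1 p.2) s := by
  have hinj : Function.Injective (fun p : ℕ × ℕ => (p.1 + 1, p.2)) := by
    rintro ⟨x, y⟩ ⟨x', y'⟩ h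
    simpa using h
  refine (hinj.hasSum_iff ?_).1 h
  rintro ⟨k, l⟩ hk
  cases k with
  | zero => simp [shiftFst]
  | succ k => exact absurd ⟨(k, l), rfl⟩ hk

theorem hasSum_shiftSnd_mul {f E : ℕ → ℕ → ℝ} {s : ℝ}
    (h : HasSum (fun p : ℕ × ℕ => f p.1 p.2 * E p.1 (p.2 + 1)) s) :
    HasSum (fun p : ℕ × ℕ => shiftSnd f p.1 p.2 * E p.1 p.2) s := by
  have hinj : Function.Injective (fun p : ℕ × ℕ => (p.1, p.2 + 1)) := by
    rintro ⟨x, y⟩ ⟨x', y'⟩ h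
    simpa using h
  refine (hinj.hasSum_iff ?_).1 h
  rintro ⟨k, l⟩ hk
  cases l with
  | zero => simp [shiftSnd]
  | succ l => exact absurd ⟨(k, l), rfl⟩ hk

/-- Summation by parts for the planar autoregressive polynomial. -/
theorem hasSum_arResidual_mul (a b c : ℝ) {ψ E : ℕ → ℕ → ℝ} {s s₁ s₂ s₃ : ℝ}
    (h : HasSum (fun p : ℕ × ℕ => ψ p.1 p.2 * E p.1 p.2) s)
    (h₁ : HasSum (fun p : ℕ × ℕ => ψ p.1 p.2 * E (p.1 + 1) p.2) s₁)
    (h₂ : HasSum (fun p : ℕ × ℕ => ψ p.1 p.2 * E p.1 (p.2 + 1)) s₂)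
    (h₃ : HasSum (fun p : ℕ × ℕ => ψ p.1 p.2 * E (p.1 + 1) (p.2 + 1)) s₃) :
    HasSum (fun p : ℕ × ℕ => arResidual a b c ψ p.1 p.2 * E p.1 p.2)
      (s - a * s₁ - b * s₂ - c * s₃) := by
  have h₃' : HasSum (fun p : ℕ × ℕ => shiftFst (shiftSnd ψ) p.1 p.2 * E p.1 p.2) s₃ :=
    hasSum_shiftFst_mul (hasSum_shiftSnd_mul (E := fun k l => E (k + 1) l) h₃)
  refine (hasSum_congr_fun fun p => ?_).2 (((h.sub ((hasSum_shiftFst_mul h₁).mul_left a)).sub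
    ((hasSum_shiftSnd_mul h₂).mul_left b)).sub (h₃'.mul_left c))
  simp only [arResidual]
  ring

theorem hasSum_deltaSeq_mul (E : ℕ → ℕ → ℝ) :
    HasSum (fun p : ℕ × ℕ => deltaSeq p.1 p.2 * E p.1 p.2) (E 0 0) := by
  have := hasSum_single (f := fun p : ℕ × ℕ => deltaSeq p.1 p.2 * E p.1 p.2) (0, 0) (by
    rintro ⟨k, l⟩ h
    have : ¬ (k = 0 ∧ l = 0) := by simpa using h
    simp [deltaSeq, this])
  simpa [deltaSeq] using this

theorem summable_abs_arResidual (a b c : ℝ) {ψ : ℕ → ℕ → ℝ}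
    (h : Summable (fun p : ℕ × ℕ => |ψ p.1 p.2|)) :
    Summable (fun p : ℕ × ℕ => |arResidual a b c ψ p.1 p.2|) := by
  have h' : HasSum (fun p : ℕ × ℕ => ψ p.1 p.2 * (1 : ℝ)) (∑' p : ℕ × ℕ, ψ p.1 p.2) := by
    simpa using h.of_abs.hasSum
  simpa using (hasSum_arResidual_mul a b c (E := fun _ _ => 1) h' h' h' h').summable.abs

/-! ### The coefficients -/

theorem arCoeff_eq_sum_range (a b c : ℝ) {k l N : ℕ} (h : min k l ≤ N) :
    arCoeff a b c k l = ∑ m ∈ Finset.range (N + 1),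
      (k.choose m : ℝ) * (l.choose m : ℝ) * a ^ (k - m) * b ^ (l - m) * (a * b + c) ^ m := by
  refine Finset.sum_subset (Finset.range_mono (by omega)) fun m _ hm => ?_
  have hm' : k < m ∨ l < m := by
    simp only [Finset.mem_range] at hm
    omega
  rcases hm' with h | h <;> simp [Nat.choose_eq_zero_of_lt h]

theorem arCoeff_zero_right (a b c : ℝ) (k : ℕ) : arCoeff a b c k 0 = a ^ k := by
  simp [arCoeff]

theorem arCoeff_zero_left (a b c : ℝ) (l : ℕ) : arCoeff a b c 0 l = b ^ l := by
  simp [arCoeff]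

theorem choose_mul_pow_succ_sub (x : ℝ) (k m : ℕ) :
    (k.choose m : ℝ) * x ^ (k + 1 - m) = x * (k.choose m * x ^ (k - m)) := by
  rcases le_or_gt m k with h | h
  · rw [Nat.sub_add_comm h, pow_succ]
    ring
  · simp [Nat.choose_eq_zero_of_lt h]

/-- With d = ab + c, Q = (1 - az)(1 - bw) - d zw. The d^m term of `arCoeff` is the coefficient of
(zw)^m / ((1 - az)(1 - bw))^(m+1), so applying (1 - az)(1 - bw) turns term m + 1 at (k+1, l+1) into
d times term m at (k, l). -/
theorem arCoeff_succ_succ (a b c : ℝ) (k l : ℕ) :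
    arCoeff a b c (k + 1) (l + 1) =
      a * arCoeff a b c k (l + 1) + b * arCoeff a b c (k + 1) l + c * arCoeff a b c k l := by
  set d := a * b + c with hd
  have hc : c = d - a * b := by rw [hd]; ring
  rw [arCoeff_eq_sum_range a b c (N := k + 1) (k := k + 1) (l := l + 1) (by omega),
    arCoeff_eq_sum_range a b c (N := k + 1) (k := k) (l := l + 1) (by omega),
    arCoeff_eq_sum_range a b c (N := k + 1) (k := k + 1) (l := l) (by omega)]
  have e₁ := arCoeff_eq_sum_range a b c (N := k + 1) (k := k) (l := l) (by omega)
  have e₂ := arCoeff_eq_sum_range a b c (N := k) (k := k) (l := l) (by omega)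
  rw [← hd] at *
  suffices H : ∑ m ∈ Finset.range (k + 1 + 1),
      (((k + 1).choose m : ℝ) * ((l + 1).choose m : ℝ) * a ^ (k + 1 - m) * b ^ (l + 1 - m) * d ^ m
        - a * ((k.choose m : ℝ) * ((l + 1).choose m : ℝ) * a ^ (k - m) * b ^ (l + 1 - m) * d ^ m)
        - b * (((k + 1).choose m : ℝ) * (l.choose m : ℝ) * a ^ (k + 1 - m) * b ^ (l - m) * d ^ m)
        + a * b * ((k.choose m : ℝ) * (l.choose m : ℝ) * a ^ (k - m) * b ^ (l - m) * d ^ m))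
      = d * arCoeff a b c k l by
    rw [Finset.sum_add_distrib, Finset.sum_sub_distrib, Finset.sum_sub_distrib,
      ← Finset.mul_sum, ← Finset.mul_sum, ← Finset.mul_sum, ← e₁] at H
    linear_combination H - hc * arCoeff a b c k l
  rw [Finset.sum_range_succ', e₂, Finset.mul_sum]
  have h0 : ∀ x y z : ℝ, y = 0 → x = z → x + y = z := by rintro x y z rfl rfl; simp
  refine h0 _ _ _ ?_ (Finset.sum_congr rfl fun m _ => ?_)
  · simp only [Nat.choose_zero_right, Nat.sub_zero, pow_zero, pow_succ]
    ring
  · have ha := choose_mul_pow_succ_sub a k (m + 1)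
    have hb := choose_mul_pow_succ_sub b l (m + 1)
    rw [Nat.add_sub_add_right] at ha hb
    rw [Nat.add_sub_add_right, Nat.add_sub_add_right, Nat.choose_succ_succ, Nat.choose_succ_succ]
    push_cast
    linear_combination
      (((l.choose m : ℝ) + l.choose (m + 1)) * b ^ (l - m) * d ^ (m + 1)
        - b * (l.choose (m + 1) * b ^ (l - (m + 1))) * d ^ (m + 1)) * ha
      + (k.choose m : ℝ) * a ^ (k - m) * d ^ (m + 1) * hb

theorem arResidual_arCoeff (a b c : ℝ) (k l : ℕ) :
    arResidual a b c (arCoeff a b c) k l = deltaSeq k l := by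
  rcases k with _ | k <;> rcases l with _ | l <;>
    simp [arResidual, shiftFst, shiftSnd, deltaSeq, arCoeff_zero_left, arCoeff_zero_right,
      arCoeff_succ_succ, pow_succ] <;> ring

theorem eq_arCoeff_of_arResidual_eq {a b c : ℝ} {ψ : ℕ → ℕ → ℝ}
    (h : ∀ k l, arResidual a b c ψ k l = deltaSeq k l) (k l : ℕ) : ψ k l = arCoeff a b c k l := by
  have H := fun k l => (h k l).trans (arResidual_arCoeff a b c k l).symm
  induction k generalizing l with
  | zero =>
    induction l with
    | zero => simpa [arResidual, shiftFst, shiftSnd] using H 0 0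
    | succ l ih => simpa [arResidual, shiftFst, shiftSnd, ih] using H 0 (l + 1)
  | succ k ihk =>
    induction l with
    | zero => simpa [arResidual, shiftFst, shiftSnd, ihk] using H (k + 1) 0
    | succ l ihl => simpa [arResidual, shiftFst, shiftSnd, ihk, ihl] using H (k + 1) (l + 1)

/-! ### The stability region -/

/-- Positivity of `1 - a z - b w - c z w` at the four points `(±1, ±1)`. -/
def IsARStable (a b c : ℝ) : Prop :=
  0 < 1 - a - b - c ∧ 0 < 1 - a + b + c ∧ 0 < 1 + a - b + c ∧ 0 < 1 + a + b - c

theorem IsARStable.exists_one_lt {a b c : ℝ} (h : IsARStable a b c) :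
    ∃ r : ℝ, 1 < r ∧ IsARStable (a * r) (b * r) (c * r ^ 2) := by
  obtain ⟨h₁, h₂, h₃, h₄⟩ := h
  have key : ∀ x y z : ℝ, 0 < 1 + x + y + z →
      ∀ᶠ r : ℝ in nhdsWithin 1 (Set.Ioi 1), 0 < 1 + x * r + y * r + z * r ^ 2 := by
    intro x y z h
    refine Filter.Eventually.filter_mono nhdsWithin_le_nhds ?_
    have hc : Continuous fun r : ℝ => 1 + x * r + y * r + z * r ^ 2 := by fun_prop
    exact hc.continuousAt.eventually_const_lt (by simpa using h)
  have hgt : ∀ᶠ r : ℝ in nhdsWithin 1 (Set.Ioi 1), 1 < r := self_mem_nhdsWithin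
  obtain ⟨r, hr, k₁, k₂, k₃, k₄⟩ := (hgt.and
    ((key (-a) (-b) (-c) (by linarith)).and ((key (-a) b c (by linarith)).and
      ((key a (-b) c (by linarith)).and (key a b (-c) (by linarith)))))).exists
  exact ⟨r, hr, by linarith, by linarith, by linarith, by linarith⟩

/-- A storage function certifying that the passage from one row of coefficients to the next
is a contraction of `ℓ²`. -/
theorem IsARStable.exists_storage {a b c : ℝ} (h : IsARStable a b c) :
    ∃ p : ℝ, 0 ≤ p ∧ ∀ s u : ℝ,
      p * (b * s + (a * b + c) * u) ^ 2 + (s + a * u) ^ 2 ≤ p * s ^ 2 + u ^ 2 := by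
  obtain ⟨h₁, h₂, h₃, h₄⟩ := h
  have hM : 0 < 1 - b ^ 2 + a ^ 2 - c ^ 2 := by nlinarith [mul_pos h₁ h₂, mul_pos h₃ h₄]
  have hN₁ : 0 < 1 - a ^ 2 - b ^ 2 + c ^ 2 - 2 * (a * b + c) := by nlinarith [mul_pos h₁ h₄]
  have hN₂ : 0 < 1 - a ^ 2 - b ^ 2 + c ^ 2 + 2 * (a * b + c) := by nlinarith [mul_pos h₂ h₃]
  set d := a * b + c with hd
  set N := 1 - a ^ 2 - b ^ 2 + c ^ 2 with hNd
  have hN : 0 < N := by linarith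
  -- For a general p the dissipation form has determinant -d²p² + Np - 1; p = 2/N makes it 1 -
  -- 4d²/N² > 0, also when d = 0.
  refine ⟨2 / N, by positivity, fun s u => ?_⟩
  have hdet : 0 < N ^ 2 - 4 * d ^ 2 := by nlinarith [mul_pos hN₁ hN₂]
  -- With `A s² - 2 B s u + C u²` the quadratic form scaled by `N`, `A > 0` and `A C - B² > 0`.
  set A := 2 * (1 - b ^ 2) - N with hA
  have hApos : 0 < A := by rw [hA, hNd]; linarith
  set B := 2 * b * d + a * N with hB
  set C := N * (1 - a ^ 2) - 2 * d ^ 2 with hC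
  have hAC : A * C - B ^ 2 = N ^ 2 - 4 * d ^ 2 := by
    rw [hA, hB, hC, hNd, hd]; ring
  have hQ : 0 ≤ A * s ^ 2 - 2 * B * s * u + C * u ^ 2 := by
    have : 0 ≤ A * (A * s ^ 2 - 2 * B * s * u + C * u ^ 2) := by
      have e : A * (A * s ^ 2 - 2 * B * s * u + C * u ^ 2)
          = (A * s - B * u) ^ 2 + (A * C - B ^ 2) * u ^ 2 := by ring
      rw [e, hAC]
      positivity
    exact nonneg_of_mul_nonneg_right this hApos
  have e : 2 / N * s ^ 2 + u ^ 2 - (2 / N * (b * s + d * u) ^ 2 + (s + a * u) ^ 2)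
      = (A * s ^ 2 - 2 * B * s * u + C * u ^ 2) / N := by
    rw [hA, hB, hC]
    field_simp
    ring
  have := div_nonneg hQ hN.le
  linarith

/-- Along a row, s = ψ(k+1,l) - aψ(k,l) is the state of a linear system with input ψ(k,l) and output
ψ(k+1,l). It starts at zero, so the storage inequality telescopes. -/
theorem IsARStable.sum_sq_arCoeff_succ_le {a b c : ℝ} (h : IsARStable a b c) (k L : ℕ) :
    ∑ l ∈ Finset.range L, arCoeff a b c (k + 1) l ^ 2 ≤
      ∑ l ∈ Finset.range L, arCoeff a b c k l ^ 2 := by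
  obtain ⟨p, hp, hpq⟩ := h.exists_storage
  have key : p * (arCoeff a b c (k + 1) L - a * arCoeff a b c k L) ^ 2
      + ∑ l ∈ Finset.range L, arCoeff a b c (k + 1) l ^ 2 ≤
      ∑ l ∈ Finset.range L, arCoeff a b c k l ^ 2 := by
    induction L with
    | zero => simp [arCoeff_zero_right, pow_succ, mul_comm]
    | succ L ih =>
      have := hpq (arCoeff a b c (k + 1) L - a * arCoeff a b c k L) (arCoeff a b c k L)
      have e : arCoeff a b c (k + 1) (L + 1) - a * arCoeff a b c k (L + 1)
          = b * (arCoeff a b c (k + 1) L - a * arCoeff a b c k L)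
            + (a * b + c) * arCoeff a b c k L := by
        rw [arCoeff_succ_succ]; ring
      rw [Finset.sum_range_succ, Finset.sum_range_succ, e]
      rw [sub_add_cancel] at this
      linarith
  have := mul_nonneg hp (sq_nonneg (arCoeff a b c (k + 1) L - a * arCoeff a b c k L))
  linarith

theorem IsARStable.exists_abs_arCoeff_le {a b c : ℝ} (h : IsARStable a b c) :
    ∃ C : ℝ, ∀ k l, |arCoeff a b c k l| ≤ C := by
  have hb : b ^ 2 < 1 := by
    obtain ⟨h₁, h₂, h₃, h₄⟩ := h
    rw [sq_lt_one_iff_abs_lt_one, abs_lt]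
    constructor <;> linarith
  have hs : Summable fun l : ℕ => (b ^ 2) ^ l := summable_geometric_of_lt_one (sq_nonneg b) hb
  refine ⟨√(∑' l : ℕ, (b ^ 2) ^ l), fun k l => Real.abs_le_sqrt ?_⟩
  have hk : ∑ l ∈ Finset.range (l + 1), arCoeff a b c k l ^ 2 ≤
      ∑ l ∈ Finset.range (l + 1), arCoeff a b c 0 l ^ 2 := by
    induction k with
    | zero => rfl
    | succ k ih => exact (h.sum_sq_arCoeff_succ_le k _).trans ih
  calc arCoeff a b c k l ^ 2
      ≤ ∑ l ∈ Finset.range (l + 1), arCoeff a b c k l ^ 2 :=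
        Finset.single_le_sum (f := fun l => arCoeff a b c k l ^ 2) (fun _ _ => sq_nonneg _)
          (Finset.self_mem_range_succ l)
    _ ≤ ∑ l ∈ Finset.range (l + 1), (b ^ 2) ^ l := by
        simpa only [arCoeff_zero_left, ← pow_mul, mul_comm] using hk
    _ ≤ ∑' l : ℕ, (b ^ 2) ^ l := hs.sum_le_tsum _ fun _ _ => by positivity

theorem arCoeff_rescale (a b c r : ℝ) (k l : ℕ) :
    arCoeff (a * r) (b * r) (c * r ^ 2) k l = r ^ k * r ^ l * arCoeff a b c k l := by
  simp only [arCoeff, Finset.mul_sum]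
  refine Finset.sum_congr rfl fun m hm => ?_
  have hm' := Finset.mem_range.1 hm
  have e : r ^ k * r ^ l = r ^ (k - m) * r ^ (l - m) * (r ^ 2) ^ m := by
    rw [← pow_mul, ← pow_add, ← pow_add, ← pow_add]
    congr 1
    omega
  have e' : a * r * (b * r) + c * r ^ 2 = (a * b + c) * r ^ 2 := by ring
  rw [e, e', mul_pow, mul_pow, mul_pow]
  ring

/-- Boundedness for the dilated parameters reads |ψ(k,l)| ≤ C r^(-k-l) with r > 1. -/
theorem IsARStable.summable_abs_arCoeff {a b c : ℝ} (h : IsARStable a b c) :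
    Summable (fun p : ℕ × ℕ => |arCoeff a b c p.1 p.2|) := by
  obtain ⟨r, hr, hst⟩ := h.exists_one_lt
  obtain ⟨C, hC⟩ := hst.exists_abs_arCoeff_le
  have hr0 : 0 < r := by linarith
  have hg : Summable fun k : ℕ => (r⁻¹) ^ k :=
    summable_geometric_of_lt_one (by positivity) (inv_lt_one_of_one_lt₀ hr)
  refine Summable.of_nonneg_of_le (fun _ => abs_nonneg _) (fun p => ?_)
    ((hg.mul_of_nonneg hg (fun _ => by positivity) fun _ => by positivity).mul_left C)
  have := hC p.1 p.2
  rw [arCoeff_rescale, abs_mul, abs_of_pos (by positivity)] at this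
  rw [inv_pow, inv_pow, ← mul_inv, ← div_eq_mul_inv, le_div_iff₀ (by positivity)]
  linarith

theorem isARStable_of_summable {a b c : ℝ} {ψ : ℕ → ℕ → ℝ}
    (hs : Summable (fun p : ℕ × ℕ => |ψ p.1 p.2|))
    (h : ∀ k l, arResidual a b c ψ k l = deltaSeq k l) : IsARStable a b c := by
  have hne : ∀ x y : ℝ, |x| ≤ 1 → |y| ≤ 1 → 1 - a * x - b * y - c * (x * y) ≠ 0 := by
    intro x y hx hy h0
    have hE : Summable fun p : ℕ × ℕ => ψ p.1 p.2 * (x ^ p.1 * y ^ p.2) := by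
      refine Summable.of_abs (hs.of_nonneg_of_le (fun _ => abs_nonneg _) fun p => ?_)
      rw [abs_mul, abs_mul, abs_pow, abs_pow]
      exact mul_le_of_le_one_right (abs_nonneg _)
        (mul_le_one₀ (pow_le_one₀ (abs_nonneg x) hx) (by positivity)
          (pow_le_one₀ (abs_nonneg y) hy))
    have H := hE.hasSum
    have := hasSum_arResidual_mul a b c (E := fun k l => x ^ k * y ^ l) H
      (by simpa only [pow_succ, mul_assoc, mul_left_comm, mul_comm] using H.mul_right x)
      (by simpa only [pow_succ, mul_assoc, mul_left_comm, mul_comm] using H.mul_right y)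
      (by simpa only [pow_succ, mul_assoc, mul_left_comm, mul_comm] using H.mul_right (x * y))
    simp only [h] at this
    have e := (hasSum_deltaSeq_mul fun k l => x ^ k * y ^ l).unique this
    simp only [pow_zero, mul_one] at e
    have e' : (1 : ℝ) = (∑' p : ℕ × ℕ, ψ p.1 p.2 * (x ^ p.1 * y ^ p.2)) *
        (1 - a * x - b * y - c * (x * y)) := by
      linear_combination e
    simp [h0] at e'
  have hpos : ∀ x y : ℝ, |x| ≤ 1 → |y| ≤ 1 → 0 < 1 - a * x - b * y - c * (x * y) := by
    intro x y hx hy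
    by_contra! hle
    -- Along the segment from the origin to (x, y), Q starts at 1 and would have to cross zero.
    have hcont : ContinuousOn
        (fun t : ℝ => 1 - a * (t * x) - b * (t * y) - c * ((t * x) * (t * y))) (Set.Icc 0 1) := by
      fun_prop
    obtain ⟨t, ht, ht0⟩ := intermediate_value_Icc' zero_le_one hcont
      (show (0 : ℝ) ∈ _ from ⟨by simpa using hle, by simp⟩)
    have ht1 : |t| ≤ 1 := abs_le.2 ⟨by linarith [ht.1], ht.2⟩
    refine hne (t * x) (t * y) ?_ ?_ ht0 <;> rw [abs_mul] <;>
      exact mul_le_one₀ ht1 (abs_nonneg _) (by assumption)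
  have h₁ := hpos 1 1 (by simp) (by simp)
  have h₂ := hpos 1 (-1) (by simp) (by simp)
  have h₃ := hpos (-1) 1 (by simp) (by simp)
  have h₄ := hpos (-1) (-1) (by simp) (by simp)
  exact ⟨by linarith, by linarith, by linarith, by linarith⟩

/-! ### Inversion of the equation for a deterministic array -/

theorem sub_natCast_succ (i : ℤ) (k : ℕ) : i - ((k + 1 : ℕ) : ℤ) = i - 1 - k := by
  push_cast
  ring

/-- An array solving the autoregressive equation is recovered from its innovations. -/
theorem hasSum_arCoeff_mul {a b c : ℝ} {x e : ℤ → ℤ → ℝ} {i j : ℤ}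
    (hx : ∀ i j, x i j = a * x (i - 1) j + b * x i (j - 1) + c * x (i - 1) (j - 1) + e i j)
    (h₀ : Summable fun p : ℕ × ℕ => arCoeff a b c p.1 p.2 * x (i - p.1) (j - p.2))
    (h₁ : Summable fun p : ℕ × ℕ => arCoeff a b c p.1 p.2 * x (i - 1 - p.1) (j - p.2))
    (h₂ : Summable fun p : ℕ × ℕ => arCoeff a b c p.1 p.2 * x (i - p.1) (j - 1 - p.2))
    (h₃ : Summable fun p : ℕ × ℕ => arCoeff a b c p.1 p.2 * x (i - 1 - p.1) (j - 1 - p.2)) :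
    HasSum (fun p : ℕ × ℕ => arCoeff a b c p.1 p.2 * e (i - p.1) (j - p.2)) (x i j) := by
  obtain ⟨s₀, h₀⟩ := h₀
  obtain ⟨s₁, h₁⟩ := h₁
  obtain ⟨s₂, h₂⟩ := h₂
  obtain ⟨s₃, h₃⟩ := h₃
  have hp := hasSum_arResidual_mul a b c (E := fun k l : ℕ => x (i - k) (j - l)) h₀
    (by simpa only [sub_natCast_succ] using h₁)
    (by simpa only [sub_natCast_succ] using h₂)
    (by simpa only [sub_natCast_succ] using h₃)
  simp only [arResidual_arCoeff] at hp
  have hs := (hasSum_deltaSeq_mul fun k l : ℕ => x (i - k) (j - l)).unique hp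
  simp only [Nat.cast_zero, sub_zero] at hs
  rw [hs]
  refine (hasSum_congr_fun fun p => ?_).2
    (((h₀.sub (h₁.mul_left a)).sub (h₂.mul_left b)).sub (h₃.mul_left c))
  have := hx (i - p.1) (j - p.2)
  rw [sub_right_comm i (p.1 : ℤ) 1, sub_right_comm j (p.2 : ℤ) 1] at this
  linear_combination -arCoeff a b c p.1 p.2 * this

/-! ### Random fields -/

section RandomField

variable {Ω : Type*} [MeasurableSpace Ω] {P : Measure Ω}

theorem integral_mul_eq_ite_of_isWhiteNoise [IsProbabilityMeasure P] {ε : ℤ → ℤ → Ω → ℝ} {σ2 : ℝ}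
    (hε : IsWhiteNoise P ε σ2) (i j i' j' : ℤ) :
    ∫ ω, ε i j ω * ε i' j' ω ∂P = if (i, j) = (i', j') then σ2 else 0 := by
  split_ifs with h
  · obtain ⟨rfl, rfl⟩ := Prod.mk.inj h
    simpa only [sq] using hε.second_moment i j
  · have := covariance_eq_sub (hε.memLp i j) (hε.memLp i' j')
    rw [hε.uncorrelated _ _ _ _ h, hε.mean_zero, zero_mul, sub_zero] at this
    exact this.symm

theorem integral_norm_mul_le {f g : Ω → ℝ} {C : ℝ} (hf : MemLp f 2 P) (hg : MemLp g 2 P)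
    (hfC : ∫ ω, f ω ^ 2 ∂P ≤ C) (hgC : ∫ ω, g ω ^ 2 ∂P ≤ C) :
    ∫ ω, ‖f ω * g ω‖ ∂P ≤ C := by
  have hint := (hf.integrable_sq.add hg.integrable_sq).div_const 2
  calc ∫ ω, ‖f ω * g ω‖ ∂P ≤ ∫ ω, (f ω ^ 2 + g ω ^ 2) / 2 ∂P := by
        refine integral_mono (hf.integrable_mul hg).norm hint fun ω => ?_
        simp only [norm_mul, Real.norm_eq_abs]
        nlinarith [sq_nonneg (|f ω| - |g ω|), sq_abs (f ω), sq_abs (g ω)]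
    _ ≤ C := by
        rw [integral_div, integral_add hf.integrable_sq hg.integrable_sq]
        linarith

/-- Multiplying the series for ε₀₀ by Z = ε₋ₖ,₋ₗ and integrating termwise leaves only the (k,l)
term; absolute summability with the uniform bound σ2 on E|εZ| permits the exchange, and σ2 > 0
cancels. -/
theorem arResidual_eq_of_isCausalRepresentation [IsProbabilityMeasure P] {a b c σ2 : ℝ}
    {ε X : ℤ → ℤ → Ω → ℝ} (hε : IsWhiteNoise P ε σ2) (hAR : SatisfiesPlanarAR P a b c X ε)
    {ψ : ℕ → ℕ → ℝ} (hψ : IsCausalRepresentation P X ε ψ) (k l : ℕ) :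
    arResidual a b c ψ k l = deltaSeq k l := by
  set φ := arResidual a b c ψ with hφ
  have hsum : ∀ᵐ ω ∂P, HasSum (fun p : ℕ × ℕ => φ p.1 p.2 * ε (0 - (p.1 : ℤ)) (0 - (p.2 : ℤ)) ω)
      (ε 0 0 ω) := by
    filter_upwards [hAR 0 0, hψ.hasSum 0 0, hψ.hasSum (0 - 1) 0, hψ.hasSum 0 (0 - 1),
      hψ.hasSum (0 - 1) (0 - 1)] with ω h h₀ h₁ h₂ h₃
    have e : ε 0 0 ω = X 0 0 ω - a * X (0 - 1) 0 ω - b * X 0 (0 - 1) ω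
        - c * X (0 - 1) (0 - 1) ω := by linarith
    rw [e]
    refine hasSum_arResidual_mul a b c (E := fun k l => ε (0 - (k : ℤ)) (0 - (l : ℤ)) ω) h₀ ?_ ?_ ?_ <;>
      simpa only [sub_natCast_succ]
  set Z := ε (0 - (k : ℤ)) (0 - (l : ℤ)) with hZ
  have hInt := hasSum_integral_of_summable_integral_norm (μ := P)
    (F := fun (p : ℕ × ℕ) ω => φ p.1 p.2 * (ε (0 - (p.1 : ℤ)) (0 - (p.2 : ℤ)) ω * Z ω))
    (fun p => ((hε.memLp _ _).integrable_mul (hε.memLp _ _)).const_mul _) (by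
      refine Summable.of_nonneg_of_le (fun _ => by positivity) (fun p => ?_)
        ((summable_abs_arResidual a b c hψ.summable_abs).mul_right σ2)
      simp only [norm_mul (φ p.1 p.2), integral_const_mul]
      exact mul_le_mul_of_nonneg_left (integral_norm_mul_le (hε.memLp _ _) (hε.memLp _ _)
        (hε.second_moment _ _).le (hε.second_moment _ _).le) (abs_nonneg _))
  have hR : ∫ ω, ∑' p : ℕ × ℕ, φ p.1 p.2 * (ε (0 - (p.1 : ℤ)) (0 - (p.2 : ℤ)) ω * Z ω) ∂P
      = deltaSeq k l * σ2 := by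
    have : ∫ ω, ∑' p : ℕ × ℕ, φ p.1 p.2 * (ε (0 - (p.1 : ℤ)) (0 - (p.2 : ℤ)) ω * Z ω) ∂P
        = ∫ ω, ε 0 0 ω * Z ω ∂P := by
      refine integral_congr_ae ?_
      filter_upwards [hsum] with ω h
      simpa only [mul_assoc] using (h.mul_right (Z ω)).tsum_eq
    rw [this, hZ, integral_mul_eq_ite_of_isWhiteNoise hε, deltaSeq]
    by_cases h : k = 0 ∧ l = 0
    · simp [h]
    · have h' : ¬ ((0 : ℤ), (0 : ℤ)) = (0 - (k : ℤ), 0 - (l : ℤ)) := by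
        rw [Prod.mk.injEq]; omega
      simp only [h, h', if_false, zero_mul]
  have hL := hasSum_single (f := fun p : ℕ × ℕ =>
      ∫ ω, φ p.1 p.2 * (ε (0 - (p.1 : ℤ)) (0 - (p.2 : ℤ)) ω * Z ω) ∂P) (k, l) (by
    rintro ⟨k', l'⟩ h
    have h' : ¬ (0 - (k' : ℤ), 0 - (l' : ℤ)) = (0 - (k : ℤ), 0 - (l : ℤ)) := by
      rw [Ne, Prod.mk.injEq] at h
      rw [Prod.mk.injEq]; omega
    simp only [integral_const_mul, hZ, integral_mul_eq_ite_of_isWhiteNoise hε, h', if_false,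
      mul_zero])
  have e := hL.unique hInt
  rw [hR, integral_const_mul, hZ, integral_mul_eq_ite_of_isWhiteNoise hε, if_pos rfl] at e
  exact mul_right_cancel₀ hε.pos.ne' e

theorem IsWideSenseStationary.exists_integral_norm_le [IsProbabilityMeasure P]
    {X : ℤ → ℤ → Ω → ℝ} (hX : IsWideSenseStationary P X) :
    ∃ C : ℝ, ∀ i j, ∫ ω, ‖X i j ω‖ ∂P ≤ C := by
  obtain ⟨m, hm⟩ := hX.mean_const
  obtain ⟨γ, hγ⟩ := hX.cov_shift
  -- The 1 in the maximum bounds the second moment of the constant factor paired with X below.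
  refine ⟨max (γ 0 0 + m * m) 1, fun i j => ?_⟩
  have h := covariance_eq_sub (hX.memLp i j) (hX.memLp i j)
  have hij := hγ i j 0 0
  rw [sub_zero, sub_zero, h, hm] at hij
  have hsq : ∫ ω, X i j ω ^ 2 ∂P = γ 0 0 + m * m := by
    rw [← hij, sub_add_cancel]
    simp only [sq, Pi.mul_apply]
  have := integral_norm_mul_le (hX.memLp i j) (memLp_const (1 : ℝ))
    (hsq.le.trans (le_max_left _ 1)) (by simp)
  simpa using this

/-- By Tonelli, the uniform L¹ bound gives the sum of absolute values a finite expectation. -/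
theorem ae_summable_mul_of_isWideSenseStationary [IsProbabilityMeasure P]
    {X : ℤ → ℤ → Ω → ℝ} (hX : IsWideSenseStationary P X) {ψ : ℕ → ℕ → ℝ}
    (hψ : Summable (fun p : ℕ × ℕ => |ψ p.1 p.2|)) (i j : ℤ) :
    ∀ᵐ ω ∂P, Summable (fun p : ℕ × ℕ => ψ p.1 p.2 * X (i - (p.1 : ℤ)) (j - (p.2 : ℤ)) ω) := by
  obtain ⟨C, hC⟩ := hX.exists_integral_norm_le
  have hi : ∀ i j, Integrable (X i j) P := fun i j => (hX.memLp i j).integrable one_le_two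
  have hlin : ∀ p : ℕ × ℕ, ∫⁻ ω, ‖ψ p.1 p.2 * X (i - (p.1 : ℤ)) (j - (p.2 : ℤ)) ω‖ₑ ∂P ≤
      ENNReal.ofReal (|ψ p.1 p.2| * C) := fun p => by
    rw [← ofReal_integral_norm_eq_lintegral_enorm ((hi _ _).const_mul _)]
    refine ENNReal.ofReal_le_ofReal ?_
    simp only [norm_mul, integral_const_mul]
    exact mul_le_mul_of_nonneg_left (hC _ _) (abs_nonneg _)
  have hC0 : 0 ≤ C := (integral_nonneg fun _ => norm_nonneg _).trans (hC 0 0)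
  have hmeas : ∀ p : ℕ × ℕ, AEMeasurable
      (fun ω => ‖ψ p.1 p.2 * X (i - (p.1 : ℤ)) (j - (p.2 : ℤ)) ω‖ₑ) P :=
    fun p => ((hi _ _).const_mul _).aestronglyMeasurable.enorm
  have hfin : ∫⁻ ω, ∑' p : ℕ × ℕ, ‖ψ p.1 p.2 * X (i - (p.1 : ℤ)) (j - (p.2 : ℤ)) ω‖ₑ ∂P ≠ ⊤ := by
    rw [lintegral_tsum hmeas]
    refine ne_top_of_le_ne_top ?_ (ENNReal.tsum_le_tsum hlin)
    rw [← ENNReal.ofReal_tsum_of_nonneg (fun p => by positivity) (hψ.mul_right C)]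
    exact ENNReal.ofReal_ne_top
  filter_upwards [ae_lt_top' (AEMeasurable.tsum hmeas) hfin] with ω hω
  refine Summable.of_norm ?_
  have := ENNReal.summable_toReal hω.ne
  simpa only [toReal_enorm] using this

theorem isCausalRepresentation_arCoeff [IsProbabilityMeasure P] {a b c : ℝ}
    {ε X : ℤ → ℤ → Ω → ℝ} (hX : IsWideSenseStationary P X) (hAR : SatisfiesPlanarAR P a b c X ε)
    (h : IsARStable a b c) : IsCausalRepresentation P X ε (arCoeff a b c) := by
  have hs := h.summable_abs_arCoeff
  refine ⟨hs, fun i j => ?_⟩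
  have hAR' : ∀ᵐ ω ∂P, ∀ i j : ℤ, X i j ω =
      a * X (i - 1) j ω + b * X i (j - 1) ω + c * X (i - 1) (j - 1) ω + ε i j ω :=
    ae_all_iff.2 fun i => ae_all_iff.2 fun j => hAR i j
  filter_upwards [hAR', ae_summable_mul_of_isWideSenseStationary hX hs i j,
    ae_summable_mul_of_isWideSenseStationary hX hs (i - 1) j,
    ae_summable_mul_of_isWideSenseStationary hX hs i (j - 1),
    ae_summable_mul_of_isWideSenseStationary hX hs (i - 1) (j - 1)] with ω hω h₀ h₁ h₂ h₃
  exact hasSum_arCoeff_mul (x := fun i j => X i j ω) (e := fun i j => ε i j ω) hω h₀ h₁ h₂ h₃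

end RandomField

theorem mainTheorem4 {Ω : Type*} [MeasurableSpace Ω] (P : Measure Ω) [IsProbabilityMeasure P]
    (a b c σ2 : ℝ) (ε X : ℤ → ℤ → Ω → ℝ)
    (hε : IsWhiteNoise P ε σ2)
    (hX : IsWideSenseStationary P X)
    (hAR : SatisfiesPlanarAR P a b c X ε) :
    (IsCausal P X ε ↔
      0 < 1 - a - b - c ∧ 0 < 1 - a + b + c ∧ 0 < 1 + a - b + c ∧ 0 < 1 + a + b - c) ∧
    (∀ ψ : ℕ → ℕ → ℝ, IsCausalRepresentation P X ε ψ →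
      ∀ k l : ℕ, ψ k l = ∑ m ∈ Finset.range (min k l + 1),
        (k.choose m : ℝ) * (l.choose m : ℝ) * a ^ (k - m) * b ^ (l - m) * (a * b + c) ^ m) := by
 
  refine ⟨⟨?_, fun h => ⟨_, isCausalRepresentation_arCoeff hX hAR h⟩⟩, fun ψ hψ =>
    eq_arCoeff_of_arResidual_eq (arResidual_eq_of_isCausalRepresentation hε hAR hψ)⟩
  rintro ⟨ψ, hψ⟩
  exact isARStable_of_summable hψ.summable_abs (arResidual_eq_of_isCausalRepresentation hε hAR hψ)
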